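/- Let $\mathbb T=\mathbb R/\mathbb Z$. Let $g:\mathbb T\to\mathbb T$ be a $C^2$ diffeomorphism with $g'>0$ and exactly two fixed points $z_r\neq z_a$, such that $\lambda_g^{\max}:=\max g'=g'(z_r)$, $\lambda_g^{\min}:=\min g'=g'(z_a)$, and $g^nz\to z_a$, $g^{-n}z\to z_r$ as $n\to\infty$ for every $z\in\mathbb T\setminus\{z_a,z_r\}$. Let $c,C,\beta>0$. Then there is a number $\alpha_0$, depending only on $g,c,C,\beta$, such that the following holds. Let $A:\mathbb T^2\to\mathbb T^2$ be a $C^2$ Anosov diffeomorphism with invariant splitting $T_{\mathrm p}\mathbb T^2=E^s_A(\mathrm p)\oplus E^u_A(\mathrm p)$ and a constant $\lambda_A<1$ such that $\|DA_{\mathrm p}w\|\le\lambda_A\|w\|$ for $w\in E^s_A(\mathrm p)$ and $\|D(A^{-1})_{\mathrm p}v\|\le\lambda_A\|v\|$ for $v\in E^u_A(\mathrm p)$. Let $r:\mathbb T\to\mathbb T$ be an orientation preserving diffeomorphism, and let $F:\mathbb T^2\times\mathbb T\to\mathbb T^2\times\mathbb T$ be $F(x,y,z)=(A(x,y),\,g(z+r(x)))$.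 Assume: (A1) $\lambda_A<\lambda_g^{\min}<1<\lambda_g^{\max}<\lambda_A^{-1}$. (A2) $r$ is $C^2$ with $c\le r'\le C$. (A3) For every $\mathrm p\in\mathbb T^2$, $E^u_A(\mathrm p)$ and $E^s_A(\mathrm p)$ are lines spanned by unit vectors $\partial^u_A(\mathrm p)$, $\partial^s_A(\mathrm p)$ with $\partial^u_A(\mathrm p)\cdot\partial_x\ge\beta$ and $\partial^s_A(\mathrm p)\cdot\partial_x\le-\beta$; and $DA_{\mathrm p}\partial_A^{u}(\mathrm p)=\alpha^{u}(\mathrm p)\,\partial_A^{u}(A\mathrm p)$, $DA_{\mathrm p}\partial_A^{s}(\mathrm p)=\alpha^{s}(\mathrm p)\,\partial_A^{s}(A\mathrm p)$ with $\alpha^u(\mathrm p),\alpha^s(\mathrm p)>0$. Let $E^c=\langle\partial_z\rangle$, and let $E^u(p)$ be the unstable space of $F$ at $p$, that is, the set of tangent vectors $v$ at $p$ for which there is $K$ with $\|D(F^{-n})_pv\|\le K\lambda_A^n$ for all $n\ge0$. A $W^u$-curve segment is the image of a regular $C^1$ curve, parametrized by a compact interval of positive length, that is everywhere tangent to $E^u$.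 If $\alpha^u_{\min}:=\inf_{\mathrm p\in\mathbb T^2}\alpha^u(\mathrm p)\ge\alpha_0$, then for every $W^u$-curve segment $W$: (i) the set $\{p\in W:\liminf_{n\to\infty}\frac1n\log\|DF^n_p|_{E^c}\|>0\}$ is dense in $W$; (ii) the set $\{p\in W:\limsup_{n\to\infty}\frac1n\log\|DF^n_p|_{E^c}\|<0\}$ is dense in $W$. -/

import Mathlib

open Filter Topology Set

noncomputable section

/-! ### Flat tori, their tangent vectors, and differentials -/

/-- The two-dimensional torus. -/
abbrev Torus2 : Type := UnitAddCircle × UnitAddCircle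

/-- The phase space `𝕋² × 𝕋`. -/
abbrev Torus3 : Type := Torus2 × UnitAddCircle

/-- The tangent space of `𝕋²` at every point, with the Euclidean norm. -/
abbrev Tan2 : Type := EuclideanSpace ℝ (Fin 2)

/-- The tangent space of `𝕋² × 𝕋` at every point, with the Euclidean norm. -/
abbrev Tan3 : Type := EuclideanSpace ℝ (Fin 3)

/-- The covering map `ℝ → 𝕋 = ℝ/ℤ`. -/
def proj1 (t : ℝ) : UnitAddCircle := (t : UnitAddCircle)

/-- The covering map `ℝ² → 𝕋²`. -/
def proj2 (v : Tan2) : Torus2 := (proj1 (v 0), proj1 (v 1))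

/-- The covering map `ℝ³ → 𝕋² × 𝕋`. -/
def proj3 (v : Tan3) : Torus3 := ((proj1 (v 0), proj1 (v 1)), proj1 (v 2))

section Differential

variable {E E' M N : Type*} [NormedAddCommGroup E] [NormedSpace ℝ E]
  [NormedAddCommGroup E'] [NormedSpace ℝ E'] [AddCommGroup M]

/-- `f : M → N` between flat tori with covering maps `π : E → M`, `ϖ : E' → N` has
differential `L` at `p`: some local lift `φ` of `w ↦ f (p + π w)` has derivative `L` at `0`.
(Tangent spaces of tori are identified with `E`, `E'` by translation.) -/
def HasTorusDerivAt (π : E → M) (ϖ : E' → N) (f : M → N) (L : E →L[ℝ] E') (p : M) : Prop :=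
  ∃ φ : E → E', (∀ᶠ w in 𝓝 (0 : E), ϖ (φ w) = f (p + π w)) ∧ HasFDerivAt φ L 0

open Classical in
/-- The differential `Df_p` of a map between flat tori (`0` if there is none). -/
def torusDeriv (π : E → M) (ϖ : E' → N) (f : M → N) (p : M) : E →L[ℝ] E' :=
  if h : ∃ L, HasTorusDerivAt π ϖ f L p then h.choose else 0

/-- `f : M → N` is of class `C²`: it has a lift of class `C²` to the universal covers. -/
def TorusC2 (π : E → M) (ϖ : E' → N) (f : M → N) : Prop :=
  ∃ Φ : E → E', ContDiff ℝ 2 Φ ∧ ∀ v, ϖ (Φ v) = f (π v)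

end Differential

/-- The derivative `f'(z)` of a circle map. -/
def circleDeriv (f : UnitAddCircle → UnitAddCircle) (z : UnitAddCircle) : ℝ :=
  torusDeriv proj1 proj1 f z 1

/-- The differential of a map of `𝕋²`. -/
def deriv2 (f : Torus2 → Torus2) (p : Torus2) : Tan2 →L[ℝ] Tan2 :=
  torusDeriv proj2 proj2 f p

/-- The differential of a map of `𝕋² × 𝕋`. -/
def deriv3 (f : Torus3 → Torus3) (p : Torus3) : Tan3 →L[ℝ] Tan3 :=
  torusDeriv proj3 proj3 f p

/-! ### The two constituents and their coupling -/

/-- `A` is a `C²` Anosov diffeomorphism of `𝕋²` with invariant splitting `Es ⊕ Eu`, whose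
expansion and contraction occur in one step, with constant `lamA < 1`. -/
structure IsAnosov (A : Torus2 ≃ Torus2) (lamA : ℝ) (Eu Es : Torus2 → Submodule ℝ Tan2) :
    Prop where
  c2 : TorusC2 proj2 proj2 A
  c2_symm : TorusC2 proj2 proj2 A.symm
  lam_lt_one : lamA < 1
  isCompl : ∀ p, IsCompl (Es p) (Eu p)
  map_stable : ∀ p, (Es p).map (deriv2 A p).toLinearMap = Es (A p)
  map_unstable : ∀ p, (Eu p).map (deriv2 A p).toLinearMap = Eu (A p)
  stable : ∀ p, ∀ w ∈ Es p, ‖deriv2 A p w‖ ≤ lamA * ‖w‖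
  unstable : ∀ p, ∀ v ∈ Eu p, ‖deriv2 A.symm p v‖ ≤ lamA * ‖v‖

/-- `g` is a gradient-like (north-south) orientation preserving `C²` diffeomorphism of the
circle with two fixed points `zr` (source) and `za` (sink), at which `g'` attains its maximum
and its minimum respectively. -/
structure IsGradientLike (g : UnitAddCircle ≃ UnitAddCircle) (zr za : UnitAddCircle) :
    Prop where
  c2 : TorusC2 proj1 proj1 g
  deriv_pos : ∀ z, 0 < circleDeriv g z
  ne : zr ≠ za
  fixed_r : g zr = zr
  fixed_a : g za = za
  max_at : ∀ z, circleDeriv g z ≤ circleDeriv g zr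
  min_at : ∀ z, circleDeriv g za ≤ circleDeriv g z
  forward : ∀ z, z ≠ zr → z ≠ za → Tendsto (fun n : ℕ => g^[n] z) atTop (𝓝 za)
  backward : ∀ z, z ≠ zr → z ≠ za → Tendsto (fun n : ℕ => g.symm^[n] z) atTop (𝓝 zr)

/-- The skew product `F(x,y,z) = (A(x,y), g(z + r(x)))`. -/
def skewProduct (A : Torus2 ≃ Torus2) (g r : UnitAddCircle ≃ UnitAddCircle) :
    Torus3 ≃ Torus3 where
  toFun p := (A p.1, g (p.2 + r p.1.1))
  invFun q := (A.symm q.1, g.symm q.2 - r (A.symm q.1).1)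
  left_inv p := by simp
  right_inv q := by simp

/-- Domination: `λ_A < λ_g^min < 1 < λ_g^max < λ_A⁻¹`, where `λ_g^max = g'(zr)` and
`λ_g^min = g'(za)`. -/
structure IsDominated (lamA : ℝ) (g : UnitAddCircle ≃ UnitAddCircle) (zr za : UnitAddCircle) :
    Prop where
  lam_lt : lamA < circleDeriv g za
  min_lt_one : circleDeriv g za < 1
  one_lt_max : 1 < circleDeriv g zr
  max_lt : circleDeriv g zr < lamA⁻¹

/-- The rotation `r` is `C²` with `c ≤ r' ≤ C`. -/
structure IsMonotoneRotation (r : UnitAddCircle ≃ UnitAddCircle) (c C : ℝ) : Prop where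
  c2 : TorusC2 proj1 proj1 r
  lower : ∀ x, c ≤ circleDeriv r x
  upper : ∀ x, circleDeriv r x ≤ C

/-- Geometry of the base map. `du p` is the unit vector in the line `Eu p` with positive
`x`-component, `ds p` the unit vector in the line `Es p` with negative `x`-component, these
components being at least `β` in absolute value, and `αu, αs > 0` are the coefficients of
expansion and contraction along them. -/
structure IsTransverseBase (A : Torus2 ≃ Torus2) (Eu Es : Torus2 → Submodule ℝ Tan2) (β : ℝ)
    (du ds : Torus2 → Tan2) (αu αs : Torus2 → ℝ) : Prop where
  norm_du : ∀ p, ‖du p‖ = 1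
  norm_ds : ∀ p, ‖ds p‖ = 1
  span_du : ∀ p, Eu p = Submodule.span ℝ {du p}
  span_ds : ∀ p, Es p = Submodule.span ℝ {ds p}
  du_x : ∀ p, β ≤ du p 0
  ds_x : ∀ p, ds p 0 ≤ -β
  map_du : ∀ p, deriv2 A p (du p) = αu p • du (A p)
  map_ds : ∀ p, deriv2 A p (ds p) = αs p • ds (A p)
  αu_pos : ∀ p, 0 < αu p
  αs_pos : ∀ p, 0 < αs p

/-! ### Unstable curves and the center exponent -/

/-- The unstable space `E^u(p)` of `F`: the tangent vectors `v` at `p` that are contracted by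
the backward iterates at the rate `lamA`, i.e. `‖D(F⁻ⁿ)_p v‖ ≤ K lamAⁿ` for all `n ≥ 0`. When
the rates of `F` on `E^c` and on the complementary stable bundle are less than `lamA⁻¹`, this
is the unstable summand of the splitting `E^u ⊕ E^c ⊕ E^s`. -/
def unstableSpace (F : Torus3 ≃ Torus3) (lamA : ℝ) (p : Torus3) : Submodule ℝ Tan3 where
  carrier := {v | ∃ K : ℝ, ∀ n : ℕ, ‖deriv3 F.symm^[n] p v‖ ≤ K * lamA ^ n}
  zero_mem' := ⟨0, fun n => by simp⟩
  add_mem' := by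
    rintro v w ⟨K, hK⟩ ⟨K', hK'⟩
    refine ⟨K + K', fun n => ?_⟩
    rw [map_add, add_mul]
    exact (norm_add_le _ _).trans (add_le_add (hK n) (hK' n))
  smul_mem' := by
    rintro a v ⟨K, hK⟩
    refine ⟨‖a‖ * K, fun n => ?_⟩
    rw [map_smul, norm_smul, mul_assoc]
    exact mul_le_mul_of_nonneg_left (hK n) (norm_nonneg a)

/-- `W` is a (compact, nondegenerate) segment of a `W^u`-curve: the image of a regular `C¹`
curve in `𝕋² × 𝕋`, given by a lift `γ : [a,b] → ℝ³`, that is everywhere tangent to `E^u`. -/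
def IsUnstableSegment (F : Torus3 ≃ Torus3) (lamA : ℝ) (W : Set Torus3) : Prop :=
  ∃ (a b : ℝ) (γ : ℝ → Tan3), a < b ∧ ContDiffOn ℝ 1 γ (Icc a b) ∧
    (∀ t ∈ Icc a b, derivWithin γ (Icc a b) t ≠ 0 ∧
      derivWithin γ (Icc a b) t ∈ unstableSpace F lamA (proj3 (γ t))) ∧
    W = (fun t => proj3 (γ t)) '' Icc a b

/-- The center direction `E^c = ⟨∂_z⟩`. -/
def centerSpace : Submodule ℝ Tan3 := Submodule.span ℝ {EuclideanSpace.single 2 1}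

/-- The finite-time center Lyapunov exponent `(1/n) log ‖DFⁿ_p|_{E^c}‖`. -/
def centerExponent (F : Torus3 → Torus3) (p : Torus3) (n : ℕ) : ℝ :=
  1 / (n : ℝ) * Real.log ‖(deriv3 F^[n] p).comp centerSpace.subtypeL‖

end

/-!
The center derivative of `F^n` at `p` is the product of `g'(z_k + r(x_k))` along the orbit of `p`,
so it suffices to find, on every piece of an unstable curve, a point with `z_k + r(x_k)` close to
the source `zr` (where `g' > 1`), respectively to the sink `za` (where `g' < 1`), for all large
`k`. The north-south dynamics of `g` is not needed beyond `g'(za) < 1 < g'(zr)`.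

Unstable vectors lie in a cone (`exists_inSlopeCone_of_mem_unstableSpace`): with base component
`a • du`, their center component is `a σ` with `0 ≤ σ ≤ C`. The sign of the slope `σ` comes from
`r' > 0` and the orientation of `du`. In this cone `z + r(x)` changes at a rate between `c β |a|`
and `2 C |a|` (`InSlopeCone.exists_rate`), while `F` multiplies `a` by `αu ≥ α₀`. Hence along an
unstable curve the lifts `θ_n` of `z_n + r(x_n)` are monotone, and each increases at least
`M = α₀ c β / (2 C)` times as fast as the previous one. Once `M ρ ≥ 1`, a subcurve on which `θ_n`
crosses an interval of length `2 ρ` has an image on which `θ_{n+1}` increases by `2`, so wraps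
around the circle and crosses any prescribed interval of length `2 ρ` again; nested intervals
yield the point (`exists_forall_near_of_expanding`, `exists_orbit_near`).
-/

open Filter Topology Set

/-! ### Covering maps of tori -/

theorem proj1_add (s t : ℝ) : proj1 (s + t) = proj1 s + proj1 t := rfl

theorem proj2_add (u v : Tan2) : proj2 (u + v) = proj2 u + proj2 v := rfl

theorem proj3_add (u v : Tan3) : proj3 (u + v) = proj3 u + proj3 v := rfl

theorem proj1_surjective : Function.Surjective proj1 := QuotientAddGroup.mk_surjective

theorem proj3_surjective : Function.Surjective proj3 := by
  rintro ⟨⟨x, y⟩, z⟩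
  obtain ⟨s, rfl⟩ := proj1_surjective x
  obtain ⟨t, rfl⟩ := proj1_surjective y
  obtain ⟨u, rfl⟩ := proj1_surjective z
  exact ⟨!₂[s, t, u], rfl⟩

theorem continuous_proj1 : Continuous proj1 := AddCircle.continuous_mk' 1

theorem continuous_proj3 : Continuous proj3 := by
  have h (i : Fin 3) : Continuous fun v : Tan3 => proj1 (v i) :=
    continuous_proj1.comp (by fun_prop)
  exact ((h 0).prodMk (h 1)).prodMk (h 2)

theorem proj1_eq_zero_iff (t : ℝ) : proj1 t = 0 ↔ ∃ n : ℤ, (n : ℝ) = t := by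
  simpa [proj1] using AddCircle.coe_eq_zero_iff (p := (1 : ℝ)) (x := t)

theorem eventually_proj1_eq_zero_imp : ∀ᶠ t in 𝓝 (0 : ℝ), proj1 t = 0 → t = 0 := by
  filter_upwards [Metric.ball_mem_nhds (0 : ℝ) one_pos] with t ht h
  obtain ⟨n, rfl⟩ := (proj1_eq_zero_iff t).1 h
  rw [mem_ball_zero_iff, Real.norm_eq_abs] at ht
  have : |n| < 1 := by exact_mod_cast ht
  rw [Int.abs_lt_one_iff.1 this, Int.cast_zero]

theorem eventually_coord_proj1_eq_zero_imp {ι : Type*} [Fintype ι] (i : ι) :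
    ∀ᶠ v in 𝓝 (0 : EuclideanSpace ℝ ι), proj1 (v i) = 0 → v i = 0 := by
  have h : Tendsto (fun v : EuclideanSpace ℝ ι => v i) (𝓝 0) (𝓝 0) := by
    have : Continuous fun v : EuclideanSpace ℝ ι => v i := by fun_prop
    simpa using this.tendsto 0
  exact h.eventually eventually_proj1_eq_zero_imp

theorem eventually_proj2_eq_zero_imp : ∀ᶠ v in 𝓝 (0 : Tan2), proj2 v = 0 → v = 0 := by
  filter_upwards [eventually_coord_proj1_eq_zero_imp (0 : Fin 2),
    eventually_coord_proj1_eq_zero_imp (1 : Fin 2)] with v h0 h1 h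
  simp only [proj2, Prod.mk_eq_zero] at h
  ext i
  fin_cases i
  · exact h0 h.1
  · exact h1 h.2

theorem eventually_proj3_eq_zero_imp : ∀ᶠ v in 𝓝 (0 : Tan3), proj3 v = 0 → v = 0 := by
  filter_upwards [eventually_coord_proj1_eq_zero_imp (0 : Fin 3),
    eventually_coord_proj1_eq_zero_imp (1 : Fin 3),
    eventually_coord_proj1_eq_zero_imp (2 : Fin 3)] with v h0 h1 h2 h
  simp only [proj3, Prod.mk_eq_zero] at h
  ext i
  fin_cases i
  · exact h0 h.1.1
  · exact h1 h.1.2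
  · exact h2 h.2

/-! ### Differentials of maps between tori -/

section TorusDeriv

variable {E E' E'' M N N' : Type*} [NormedAddCommGroup E] [NormedSpace ℝ E]
  [NormedAddCommGroup E'] [NormedSpace ℝ E'] [NormedAddCommGroup E''] [NormedSpace ℝ E'']
  [AddCommGroup M]
  {π : E → M} {ϖ : E' → N} {κ : E'' → N'} {f : M → N} {L L' : E →L[ℝ] E'} {p : M}

/-- Two local lifts differ by a kernel element of the covering map; as the kernel is discrete,
the difference is locally constant. -/
theorem HasTorusDerivAt.unique [AddCommGroup N] (hϖ : ∀ u v, ϖ (u + v) = ϖ u + ϖ v)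
    (hker : ∀ᶠ v in 𝓝 (0 : E'), ϖ v = 0 → v = 0)
    (h : HasTorusDerivAt π ϖ f L p) (h' : HasTorusDerivAt π ϖ f L' p) : L = L' := by
  obtain ⟨φ, hφ, hL⟩ := h
  obtain ⟨ψ, hψ, hL'⟩ := h'
  have hsub : HasFDerivAt (fun w => φ w - ψ w - (φ 0 - ψ 0)) (L - L') 0 :=
    (hL.sub hL').sub_const _
  have ht : Tendsto (fun w => φ w - ψ w - (φ 0 - ψ 0)) (𝓝 0) (𝓝 0) := by
    simpa using hsub.continuousAt.tendsto
  have hzero : ∀ᶠ w in 𝓝 (0 : E), φ w - ψ w - (φ 0 - ψ 0) = 0 := by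
    filter_upwards [ht.eventually hker, hφ, hψ] with w hw h1 h2
    apply hw
    have key : φ w - ψ w - (φ 0 - ψ 0) + (ψ w + φ 0) = φ w + ψ 0 := by abel
    have := congrArg ϖ key
    rw [hϖ, hϖ, hϖ, h1, h2, hφ.self_of_nhds, hψ.self_of_nhds] at this
    simpa using this
  have h0 : HasFDerivAt (fun w => φ w - ψ w - (φ 0 - ψ 0)) (0 : E →L[ℝ] E') 0 :=
    (hasFDerivAt_const (0 : E') (0 : E)).congr_of_eventuallyEq hzero
  exact sub_eq_zero.1 (hsub.unique h0)

theorem HasTorusDerivAt.torusDeriv_eq [AddCommGroup N] (hϖ : ∀ u v, ϖ (u + v) = ϖ u + ϖ v)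
    (hker : ∀ᶠ v in 𝓝 (0 : E'), ϖ v = 0 → v = 0)
    (h : HasTorusDerivAt π ϖ f L p) : torusDeriv π ϖ f p = L := by
  have hex : ∃ L, HasTorusDerivAt π ϖ f L p := ⟨L, h⟩
  rw [torusDeriv, dif_pos hex]
  exact hex.choose_spec.unique hϖ hker h

theorem HasTorusDerivAt.of_lift (hπ : ∀ u v, π (u + v) = π u + π v) {Φ : E → E'}
    (hΦ : ∀ v, ϖ (Φ v) = f (π v)) {v : E} (hL : HasFDerivAt Φ L v) :
    HasTorusDerivAt π ϖ f L (π v) := by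
  refine ⟨fun w => Φ (v + w), Eventually.of_forall fun w => by rw [hΦ, hπ], ?_⟩
  exact (hasFDerivAt_comp_add_left (f := Φ) (x := (0 : E)) v).2 (by simpa using hL)

theorem HasTorusDerivAt.comp [AddCommGroup N] (hπ : ∀ u v, π (u + v) = π u + π v)
    (hϖ : ∀ u v, ϖ (u + v) = ϖ u + ϖ v) {h : N → N'} {L₂ : E' →L[ℝ] E''}
    (hh : HasTorusDerivAt ϖ κ h L₂ (f p)) (hf : HasTorusDerivAt π ϖ f L p) :
    HasTorusDerivAt π κ (h ∘ f) (L₂.comp L) p := by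
  obtain ⟨ψ, hψ, hL₂⟩ := hh
  obtain ⟨φ, hφ, hL⟩ := hf
  have hsub : HasFDerivAt (fun w => φ w - φ 0) L 0 := hL.sub_const _
  have ht : Tendsto (fun w => φ w - φ 0) (𝓝 0) (𝓝 0) := by
    simpa using hsub.continuousAt.tendsto
  have hπ0 : π 0 = 0 := by simpa using hπ 0 0
  have hφ0 : ϖ (φ 0) = f p := by simpa [hπ0] using hφ.self_of_nhds
  refine ⟨fun w => ψ (φ w - φ 0), ?_, ?_⟩
  · filter_upwards [ht.eventually hψ, hφ] with w hw h1
    rw [hw, Function.comp_apply, ← h1, ← hφ0, ← hϖ, add_sub_cancel]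
  · exact HasFDerivAt.comp (0 : E) (by simpa using hL₂) hsub

theorem HasTorusDerivAt.iterate_succ (hπ : ∀ u v, π (u + v) = π u + π v) {f : M → M} {n : ℕ}
    {L L' : E →L[ℝ] E} (hn : HasTorusDerivAt π π f^[n] L p)
    (h : HasTorusDerivAt π π f L' (f^[n] p)) :
    HasTorusDerivAt π π f^[n + 1] (L'.comp L) p := by
  rw [Function.iterate_succ']
  exact h.comp hπ hπ hn

theorem exists_hasTorusDerivAt_iterate (hπ : ∀ u v, π (u + v) = π u + π v)
    (hsurj : Function.Surjective π) {f : M → M}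
    (h : ∀ p, ∃ L, HasTorusDerivAt π π f L p) (n : ℕ) (p : M) :
    ∃ L, HasTorusDerivAt π π f^[n] L p := by
  induction n with
  | zero =>
    obtain ⟨v, rfl⟩ := hsurj p
    exact ⟨_, .of_lift (Φ := id) hπ (fun _ => rfl) (hasFDerivAt_id v)⟩
  | succ n ih =>
    obtain ⟨L, hL⟩ := ih
    obtain ⟨L', hL'⟩ := h (f^[n] p)
    exact ⟨_, hL.iterate_succ hπ hL'⟩

/-- The inverse function theorem, applied to a lift, differentiates the inverse map. -/
theorem exists_hasTorusDerivAt_symm [CompleteSpace E] {π : E → N'} [AddCommGroup N]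
    (hϖ : ∀ u v, ϖ (u + v) = ϖ u + ϖ v) {f : N' ≃ N} {Φ : E → E'}
    (hΦ : ∀ v, ϖ (Φ v) = f (π v)) {v : E} {L : E ≃L[ℝ] E'}
    (hL : HasStrictFDerivAt Φ (L : E →L[ℝ] E') v) :
    ∃ L', HasTorusDerivAt ϖ π f.symm L' (f (π v)) := by
  have hinv := hL.to_localInverse.hasFDerivAt
  refine ⟨(L.symm : E' →L[ℝ] E), fun w => hL.localInverse Φ L v (Φ v + w), ?_, ?_⟩
  · have ht : Tendsto (fun w => Φ v + w) (𝓝 0) (𝓝 (Φ v)) := by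
      have : Continuous fun w => Φ v + w := by fun_prop
      simpa using this.tendsto 0
    filter_upwards [ht.eventually hL.eventually_right_inverse] with w hw
    rw [Equiv.eq_symm_apply, ← hΦ, hw, hϖ, hΦ]
  · exact (hasFDerivAt_comp_add_left (x := (0 : E')) (Φ v)).2 (by simpa using hinv)

end TorusDeriv

/-! ### The differential of the skew product -/

/-- The linear projection of `ℝ³` to the base coordinates. -/
noncomputable def baseProj : Tan3 →L[ℝ] Tan2 :=
  LinearMap.toContinuousLinearMap
    { toFun := fun v => !₂[v 0, v 1]
      map_add' := fun u v => by ext i; fin_cases i <;> simp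
      map_smul' := fun a v => by ext i; fin_cases i <;> simp }

/-- The inclusion of `ℝ²` in `ℝ³` as the base coordinates. -/
noncomputable def baseIncl : Tan2 →L[ℝ] Tan3 :=
  LinearMap.toContinuousLinearMap
    { toFun := fun v => !₂[v 0, v 1, 0]
      map_add' := fun u v => by ext i; fin_cases i <;> simp
      map_smul' := fun a v => by ext i; fin_cases i <;> simp }

/-- The center vector `∂_z`. -/
noncomputable def centerVec : Tan3 := EuclideanSpace.single 2 1

@[simp] theorem baseProj_zero (v : Tan3) : baseProj v 0 = v 0 := rfl
@[simp] theorem baseProj_one (v : Tan3) : baseProj v 1 = v 1 := rfl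
@[simp] theorem baseIncl_zero (v : Tan2) : baseIncl v 0 = v 0 := rfl
@[simp] theorem baseIncl_one (v : Tan2) : baseIncl v 1 = v 1 := rfl
@[simp] theorem baseIncl_two (v : Tan2) : baseIncl v 2 = 0 := rfl
@[simp] theorem centerVec_zero : centerVec 0 = 0 := by simp [centerVec]
@[simp] theorem centerVec_one : centerVec 1 = 0 := by simp [centerVec]
@[simp] theorem centerVec_two : centerVec 2 = 1 := by simp [centerVec]
theorem norm_centerVec : ‖centerVec‖ = 1 := by simp [centerVec]

@[simp] theorem baseProj_baseIncl (w : Tan2) : baseProj (baseIncl w) = w := by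
  ext i; fin_cases i <;> rfl

@[simp] theorem baseProj_centerVec : baseProj centerVec = 0 := by
  ext i; fin_cases i <;> simp

theorem baseIncl_add_smul_centerVec (v : Tan3) : baseIncl (baseProj v) + v 2 • centerVec = v := by
  ext i; fin_cases i <;> simp

theorem norm_baseProj_le (v : Tan3) : ‖baseProj v‖ ≤ ‖v‖ := by
  rw [EuclideanSpace.norm_eq, EuclideanSpace.norm_eq]
  apply Real.sqrt_le_sqrt
  simp only [Fin.sum_univ_two, Fin.sum_univ_three, baseProj_zero, baseProj_one]
  nlinarith [sq_nonneg ‖v 2‖]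

theorem proj3_eq (v : Tan3) : proj3 v = (proj2 (baseProj v), proj1 (v 2)) := rfl

/-- The linear map `(w, s) ↦ (L w, a (s + b w₀))`, the form of the differential of a skew
product. -/
noncomputable def skewLinear (L : Tan2 →L[ℝ] Tan2) (a b : ℝ) : Tan3 →L[ℝ] Tan3 :=
  (baseIncl.comp L).comp baseProj +
    (a • (EuclideanSpace.proj (𝕜 := ℝ) (2 : Fin 3) +
      b • (EuclideanSpace.proj (𝕜 := ℝ) (0 : Fin 3))) : Tan3 →L[ℝ] ℝ).smulRight centerVec

theorem skewLinear_apply (L : Tan2 →L[ℝ] Tan2) (a b : ℝ) (v : Tan3) :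
    skewLinear L a b v = baseIncl (L (baseProj v)) + (a * (v 2 + b * v 0)) • centerVec := by
  simp [skewLinear, mul_add]

@[simp] theorem baseProj_skewLinear (L : Tan2 →L[ℝ] Tan2) (a b : ℝ) (v : Tan3) :
    baseProj (skewLinear L a b v) = L (baseProj v) := by
  simp [skewLinear_apply]

@[simp] theorem skewLinear_two (L : Tan2 →L[ℝ] Tan2) (a b : ℝ) (v : Tan3) :
    skewLinear L a b v 2 = a * (v 2 + b * v 0) := by
  simp [skewLinear_apply]

@[simp] theorem skewLinear_centerVec (L : Tan2 →L[ℝ] Tan2) (a b : ℝ) :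
    skewLinear L a b centerVec = a • centerVec := by
  simp [skewLinear_apply]

/-- The lift of the skew product built from lifts of its constituents. -/
noncomputable def skewLift (Φ : Tan2 → Tan2) (G R : ℝ → ℝ) (v : Tan3) : Tan3 :=
  baseIncl (Φ (baseProj v)) + G (v 2 + R (v 0)) • centerVec

theorem contDiff_skewLift {Φ : Tan2 → Tan2} {G R : ℝ → ℝ} (hΦ : ContDiff ℝ 2 Φ)
    (hG : ContDiff ℝ 2 G) (hR : ContDiff ℝ 2 R) : ContDiff ℝ 2 (skewLift Φ G R) := by
  have h (i : Fin 3) : ContDiff ℝ 2 fun v : Tan3 => v i :=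
    (EuclideanSpace.proj (𝕜 := ℝ) i).contDiff
  exact (baseIncl.contDiff.comp (hΦ.comp baseProj.contDiff)).add
    ((hG.comp ((h 2).add (hR.comp (h 0)))).smul contDiff_const)

theorem hasFDerivAt_skewLift {Φ : Tan2 → Tan2} {G R : ℝ → ℝ} {v : Tan3}
    {L : Tan2 →L[ℝ] Tan2} {a b : ℝ} (hΦ : HasFDerivAt Φ L (baseProj v))
    (hG : HasDerivAt G a (v 2 + R (v 0))) (hR : HasDerivAt R b (v 0)) :
    HasFDerivAt (skewLift Φ G R) (skewLinear L a b) v := by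
  have h (i : Fin 3) : HasFDerivAt (fun v : Tan3 => v i) (EuclideanSpace.proj (𝕜 := ℝ) i) v :=
    (EuclideanSpace.proj (𝕜 := ℝ) i).hasFDerivAt
  have hθ := (h 2).add (hR.comp_hasFDerivAt v (h 0))
  have hz := (hG.comp_hasFDerivAt v hθ).smul_const centerVec
  have hb := baseIncl.hasFDerivAt.comp v (hΦ.comp v baseProj.hasFDerivAt)
  exact hb.add hz

theorem proj3_skewLift {A : Torus2 ≃ Torus2} {g r : UnitAddCircle ≃ UnitAddCircle}
    {Φ : Tan2 → Tan2} {G R : ℝ → ℝ} (hΦ : ∀ v, proj2 (Φ v) = A (proj2 v))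
    (hG : ∀ t, proj1 (G t) = g (proj1 t)) (hR : ∀ t, proj1 (R t) = r (proj1 t)) (v : Tan3) :
    proj3 (skewLift Φ G R v) = skewProduct A g r (proj3 v) := by
  simp only [proj3_eq, skewLift, map_add, map_smul, baseProj_baseIncl, baseProj_centerVec,
    smul_zero, add_zero, hΦ, PiLp.add_apply, PiLp.smul_apply, baseIncl_two, centerVec_two,
    smul_eq_mul, mul_one, zero_add, hG, proj1_add, hR]
  rfl

theorem hasFDerivAt_deriv2 {f : Torus2 → Torus2} {Φ : Tan2 → Tan2} (hd : ContDiff ℝ 2 Φ)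
    (hΦ : ∀ v, proj2 (Φ v) = f (proj2 v)) (v : Tan2) : HasFDerivAt Φ (deriv2 f (proj2 v)) v := by
  have h : HasFDerivAt Φ (fderiv ℝ Φ v) v :=
    (hd.differentiable (by norm_num)).differentiableAt.hasFDerivAt
  rwa [deriv2, (HasTorusDerivAt.of_lift proj2_add hΦ h).torusDeriv_eq proj2_add
    eventually_proj2_eq_zero_imp]

theorem hasDerivAt_circleDeriv {f : UnitAddCircle → UnitAddCircle} {G : ℝ → ℝ}
    (hd : ContDiff ℝ 2 G) (hG : ∀ t, proj1 (G t) = f (proj1 t)) (t : ℝ) :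
    HasDerivAt G (circleDeriv f (proj1 t)) t := by
  have h : HasFDerivAt G (fderiv ℝ G t) t :=
    (hd.differentiable (by norm_num)).differentiableAt.hasFDerivAt
  rw [circleDeriv, (HasTorusDerivAt.of_lift proj1_add hG h).torusDeriv_eq proj1_add
    eventually_proj1_eq_zero_imp]
  exact h.hasDerivAt

/-- The differential of the skew product at `p`. -/
noncomputable def skewDeriv (A : Torus2 ≃ Torus2) (g r : UnitAddCircle ≃ UnitAddCircle)
    (p : Torus3) : Tan3 →L[ℝ] Tan3 :=
  skewLinear (deriv2 A p.1) (circleDeriv g (p.2 + r p.1.1)) (circleDeriv r p.1.1)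

section Skew

variable {A : Torus2 ≃ Torus2} {g r : UnitAddCircle ≃ UnitAddCircle}

theorem exists_skewLift (hA : TorusC2 proj2 proj2 A) (hg : TorusC2 proj1 proj1 g)
    (hr : TorusC2 proj1 proj1 r) : ∃ Φ : Tan3 → Tan3, ContDiff ℝ 2 Φ ∧
      (∀ v, proj3 (Φ v) = skewProduct A g r (proj3 v)) ∧
      ∀ v, HasFDerivAt Φ (skewDeriv A g r (proj3 v)) v := by
  obtain ⟨Φ, hΦ, hΦA⟩ := hA
  obtain ⟨G, hG, hGg⟩ := hg
  obtain ⟨R, hR, hRr⟩ := hr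
  refine ⟨skewLift Φ G R, contDiff_skewLift hΦ hG hR, proj3_skewLift hΦA hGg hRr, fun v => ?_⟩
  refine hasFDerivAt_skewLift (hasFDerivAt_deriv2 hΦ hΦA (baseProj v)) ?_
    (hasDerivAt_circleDeriv hR hRr _)
  have := hasDerivAt_circleDeriv hG hGg (v 2 + R (v 0))
  rwa [proj1_add, hRr] at this

theorem hasTorusDerivAt_skewProduct (hA : TorusC2 proj2 proj2 A) (hg : TorusC2 proj1 proj1 g)
    (hr : TorusC2 proj1 proj1 r) (p : Torus3) :
    HasTorusDerivAt proj3 proj3 (skewProduct A g r) (skewDeriv A g r p) p := by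
  obtain ⟨Φ, -, hΦ, hd⟩ := exists_skewLift hA hg hr
  obtain ⟨v, rfl⟩ := proj3_surjective p
  exact .of_lift proj3_add hΦ (hd v)

theorem exists_hasTorusDerivAt_skewProduct_symm (hA : TorusC2 proj2 proj2 A)
    (hg : TorusC2 proj1 proj1 g) (hr : TorusC2 proj1 proj1 r)
    (hinj : ∀ p, Function.Injective (skewDeriv A g r p)) (p : Torus3) :
    ∃ L, HasTorusDerivAt proj3 proj3 (skewProduct A g r).symm L p := by
  obtain ⟨Φ, hC2, hΦ, hd⟩ := exists_skewLift hA hg hr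
  obtain ⟨v, hv⟩ := proj3_surjective ((skewProduct A g r).symm p)
  have hp : skewProduct A g r (proj3 v) = p := by rw [hv, Equiv.apply_symm_apply]
  let L : Tan3 ≃L[ℝ] Tan3 := (LinearEquiv.ofInjectiveEndo
    (skewDeriv A g r (proj3 v)).toLinearMap (hinj _)).toContinuousLinearEquiv
  have hL : (L : Tan3 →L[ℝ] Tan3) = skewDeriv A g r (proj3 v) := by
    ext1 w
    rfl
  have hs : HasStrictFDerivAt Φ (L : Tan3 →L[ℝ] Tan3) v :=
    hC2.contDiffAt.hasStrictFDerivAt' (hL ▸ hd v) (by norm_num)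
  obtain ⟨L', h⟩ := exists_hasTorusDerivAt_symm proj3_add hΦ hs
  exact ⟨L', hp ▸ h⟩

/-- The center bundle is invariant, and `F^n` multiplies `∂_z` by the product of the derivatives
of `g` along the orbit. -/
theorem deriv3_iterate_centerVec (hA : TorusC2 proj2 proj2 A) (hg : TorusC2 proj1 proj1 g)
    (hr : TorusC2 proj1 proj1 r) (p : Torus3) (n : ℕ) :
    deriv3 (skewProduct A g r)^[n] p centerVec =
      (∏ k ∈ Finset.range n, circleDeriv g (((skewProduct A g r)^[k] p).2 +
        r ((skewProduct A g r)^[k] p).1.1)) • centerVec := by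
  have hF := hasTorusDerivAt_skewProduct hA hg hr
  suffices ∃ L, HasTorusDerivAt proj3 proj3 (skewProduct A g r)^[n] L p ∧ L centerVec =
      (∏ k ∈ Finset.range n, circleDeriv g (((skewProduct A g r)^[k] p).2 +
        r ((skewProduct A g r)^[k] p).1.1)) • centerVec by
    obtain ⟨L, hL, h⟩ := this
    rw [deriv3, hL.torusDeriv_eq proj3_add eventually_proj3_eq_zero_imp, h]
  induction n with
  | zero =>
    obtain ⟨v, rfl⟩ := proj3_surjective p
    exact ⟨_, .of_lift (Φ := id) proj3_add (fun _ => rfl) (hasFDerivAt_id v), by simp⟩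
  | succ n ih =>
    obtain ⟨L, hL, h⟩ := ih
    refine ⟨_, hL.iterate_succ proj3_add (hF _), ?_⟩
    rw [ContinuousLinearMap.comp_apply, h, map_smul, skewDeriv, skewLinear_centerVec, smul_smul,
      Finset.prod_range_succ]

theorem norm_comp_centerSpace_subtypeL {L : Tan3 →L[ℝ] Tan3} {a : ℝ}
    (h : L centerVec = a • centerVec) : ‖L.comp centerSpace.subtypeL‖ = |a| := by
  apply le_antisymm
  · refine ContinuousLinearMap.opNorm_le_bound _ (abs_nonneg a) fun ⟨v, hv⟩ => ?_
    obtain ⟨t, rfl⟩ := Submodule.mem_span_singleton.1 hv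
    change ‖L (t • centerVec)‖ ≤ |a| * ‖t • centerVec‖
    rw [map_smul, h, smul_comm, norm_smul a, Real.norm_eq_abs]
  · have := (L.comp centerSpace.subtypeL).le_opNorm
      ⟨centerVec, Submodule.mem_span_singleton_self _⟩
    change ‖L centerVec‖ ≤ _ * ‖centerVec‖ at this
    rwa [h, norm_smul, norm_centerVec, mul_one, mul_one, Real.norm_eq_abs] at this

theorem centerExponent_skewProduct (hA : TorusC2 proj2 proj2 A) (hg : TorusC2 proj1 proj1 g)
    (hr : TorusC2 proj1 proj1 r) (hpos : ∀ z, 0 < circleDeriv g z) (p : Torus3) (n : ℕ) :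
    centerExponent (skewProduct A g r) p n =
      (∑ k ∈ Finset.range n, Real.log (circleDeriv g (((skewProduct A g r)^[k] p).2 +
        r ((skewProduct A g r)^[k] p).1.1))) / n := by
  rw [centerExponent, norm_comp_centerSpace_subtypeL (deriv3_iterate_centerVec hA hg hr p n),
    Real.log_abs, Real.log_prod fun k _ => (hpos _).ne', one_div_mul_eq_div]

end Skew

/-! ### Averages of eventually signed sequences -/

theorem liminf_average_pos {u : ℕ → ℝ} {m b : ℝ} {N : ℕ} (hm : 0 < m) (hb : ∀ n, u n ≤ b)
    (hu : ∀ n ≥ N, m ≤ u n) :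
    0 < liminf (fun n : ℕ => (∑ k ∈ Finset.range n, u k) / n) atTop := by
  have hlow : ∀ n ≥ N, ∑ k ∈ Finset.range N, u k + ((n : ℝ) - N) * m ≤
      ∑ k ∈ Finset.range n, u k := fun n hn => by
    induction n, hn using Nat.le_induction with
    | base => simp
    | succ n hn ih =>
      rw [Finset.sum_range_succ]
      push_cast
      linarith [hu n hn]
  have hlim : Tendsto (fun n : ℕ => (n : ℝ) * (m / 2)) atTop atTop :=
    tendsto_natCast_atTop_atTop.atTop_mul_const (by positivity)
  have hev : ∀ᶠ n : ℕ in atTop, m / 2 ≤ (∑ k ∈ Finset.range n, u k) / n := by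
    filter_upwards [hlim.eventually_ge_atTop (N * m - ∑ k ∈ Finset.range N, u k),
      eventually_ge_atTop N, eventually_gt_atTop 0] with n h1 h2 h3
    rw [le_div_iff₀ (by exact_mod_cast h3)]
    linarith [hlow n h2]
  have hbdd : IsCoboundedUnder (· ≥ ·) atTop fun n : ℕ => (∑ k ∈ Finset.range n, u k) / n := by
    refine IsBoundedUnder.isCoboundedUnder_ge ⟨b, eventually_map.2 ?_⟩
    filter_upwards [eventually_gt_atTop 0] with n hn
    rw [div_le_iff₀ (by exact_mod_cast hn)]
    calc ∑ k ∈ Finset.range n, u k ≤ ∑ _k ∈ Finset.range n, b := Finset.sum_le_sum fun k _ => hb k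
      _ = b * n := by simp [mul_comm]
  exact (half_pos hm).trans_le (le_liminf_of_le hbdd hev)

theorem limsup_average_neg {u : ℕ → ℝ} {m b : ℝ} {N : ℕ} (hm : m < 0) (hb : ∀ n, b ≤ u n)
    (hu : ∀ n ≥ N, u n ≤ m) :
    limsup (fun n : ℕ => (∑ k ∈ Finset.range n, u k) / n) atTop < 0 := by
  have hhigh : ∀ n ≥ N, ∑ k ∈ Finset.range n, u k ≤
      ∑ k ∈ Finset.range N, u k + ((n : ℝ) - N) * m := fun n hn => by
    induction n, hn using Nat.le_induction with
    | base => simp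
    | succ n hn ih =>
      rw [Finset.sum_range_succ]
      push_cast
      linarith [hu n hn]
  have hlim : Tendsto (fun n : ℕ => (n : ℝ) * (-m / 2)) atTop atTop :=
    tendsto_natCast_atTop_atTop.atTop_mul_const (by linarith)
  have hev : ∀ᶠ n : ℕ in atTop, (∑ k ∈ Finset.range n, u k) / n ≤ m / 2 := by
    filter_upwards [hlim.eventually_ge_atTop (∑ k ∈ Finset.range N, u k - N * m),
      eventually_ge_atTop N, eventually_gt_atTop 0] with n h1 h2 h3
    rw [div_le_iff₀ (by exact_mod_cast h3)]
    linarith [hhigh n h2]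
  have hbdd : IsCoboundedUnder (· ≤ ·) atTop fun n : ℕ => (∑ k ∈ Finset.range n, u k) / n := by
    refine IsBoundedUnder.isCoboundedUnder_le ⟨b, eventually_map.2 ?_⟩
    filter_upwards [eventually_gt_atTop 0] with n hn
    change b ≤ _
    rw [le_div_iff₀ (by exact_mod_cast hn)]
    calc b * n = ∑ _k ∈ Finset.range n, b := by simp [mul_comm]
      _ ≤ ∑ k ∈ Finset.range n, u k := Finset.sum_le_sum fun k _ => hb k
  exact (limsup_le_of_le hbdd hev).trans_lt (by linarith)

/-! ### Orbits of expanding sequences of functions -/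

/-- An interval on which the continuous `θ` increases by at least `2` contains a subinterval
that `θ` maps onto `[x + m - ρ, x + m + ρ]` for some integer `m`. -/
theorem exists_subinterval_of_two_le {θ : ℝ → ℝ} {a b x ρ : ℝ} (hab : a ≤ b)
    (hθ : ContinuousOn θ (Icc a b)) (hmono : MonotoneOn θ (Icc a b)) (hρ : 0 < ρ) (hρ1 : ρ ≤ 1 / 2)
    (h2 : 2 ≤ θ b - θ a) :
    ∃ a' b', a ≤ a' ∧ a' ≤ b' ∧ b' ≤ b ∧ θ b' - θ a' = 2 * ρ ∧
      ∃ m : ℤ, ∀ t ∈ Icc a' b', |θ t - x - m| ≤ ρ := by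
  obtain ⟨m, hm1, hm2⟩ : ∃ m : ℤ, θ a ≤ x + m - ρ ∧ x + m - ρ ≤ θ a + 1 := by
    refine ⟨⌈θ a - x + ρ⌉, ?_, ?_⟩
    · linarith [Int.le_ceil (θ a - x + ρ)]
    · linarith [Int.ceil_lt_add_one (θ a - x + ρ)]
  obtain ⟨a', ha', hθa⟩ := intermediate_value_Icc hab hθ
    (show x + m - ρ ∈ Icc (θ a) (θ b) from ⟨hm1, by linarith⟩)
  obtain ⟨b', hb', hθb⟩ := intermediate_value_Icc hab hθ
    (show x + m + ρ ∈ Icc (θ a) (θ b) from ⟨by linarith, by linarith⟩)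
  have hle : a' ≤ b' := by
    by_contra! h
    linarith [hmono hb' ha' h.le]
  refine ⟨a', b', ha'.1, hle, hb'.2, by linarith, m, fun t ht => ?_⟩
  have htm : t ∈ Icc a b := ⟨ha'.1.trans ht.1, ht.2.trans hb'.2⟩
  have h1 := hmono ha' htm ht.1
  have h2 := hmono htm hb' ht.2
  rw [abs_le]
  constructor <;> linarith

/-- If each `θ (n+1)` increases at least `M` times as fast as `θ n`, and `M` is large compared to
`1 / ρ`, then some point has all but finitely many of its values `θ n t` within `ρ` of
`x + ℤ`. -/
theorem exists_forall_near_of_expanding {θ : ℕ → ℝ → ℝ} {a b x ρ M : ℝ} (hab : a ≤ b)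
    (hθ : ∀ n, ContinuousOn (θ n) (Icc a b)) (hmono : ∀ n, MonotoneOn (θ n) (Icc a b))
    (hexp : ∀ n, ∀ s ∈ Icc a b, ∀ t ∈ Icc a b, s ≤ t →
      M * (θ n t - θ n s) ≤ θ (n + 1) t - θ (n + 1) s)
    (h0 : θ 0 a < θ 0 b) (hρ : 0 < ρ) (hρ1 : ρ ≤ 1 / 2) (hM : 1 ≤ M * ρ) :
    ∃ t ∈ Icc a b, ∃ N, ∀ n ≥ N, ∃ m : ℤ, |θ n t - x - m| ≤ ρ := by
  have hM2 : 2 ≤ M := by nlinarith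
  have hma : a ∈ Icc a b := left_mem_Icc.2 hab
  have hmb : b ∈ Icc a b := right_mem_Icc.2 hab
  -- The increment over `[a, b]` grows geometrically, so it reaches `2`.
  obtain ⟨N, hN⟩ : ∃ N, 2 ≤ θ N b - θ N a := by
    have hgrow : ∀ n, 2 ^ n * (θ 0 b - θ 0 a) ≤ θ n b - θ n a := fun n => by
      induction n with
      | zero => simp
      | succ n ih =>
        have h1 := hexp n a hma b hmb hab
        have h2 : 0 ≤ θ n b - θ n a := sub_nonneg.2 (hmono n hma hmb hab)
        rw [pow_succ]
        nlinarith
    obtain ⟨N, hN⟩ := pow_unbounded_of_one_lt (2 / (θ 0 b - θ 0 a)) one_lt_two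
    exact ⟨N, ((div_lt_iff₀ (sub_pos.2 h0)).1 hN).le.trans (hgrow N)⟩
  -- From time `N` on, nested intervals whose images have increment at least `2`.
  let P : ℕ → ℝ × ℝ → Prop := fun n I => a ≤ I.1 ∧ I.1 ≤ I.2 ∧ I.2 ≤ b ∧ 2 ≤ θ n I.2 - θ n I.1
  have hstep : ∀ n (I : ℝ × ℝ), P n I → ∃ I' : ℝ × ℝ, P (n + 1) I' ∧ I.1 ≤ I'.1 ∧ I'.2 ≤ I.2 ∧
      ∀ t ∈ Icc I'.1 I'.2, ∃ m : ℤ, |θ n t - x - m| ≤ ρ := by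
    rintro n ⟨c, d⟩ ⟨hc, hcd, hd, h2⟩
    have hsub : Icc c d ⊆ Icc a b := Icc_subset_Icc hc hd
    obtain ⟨c', d', hc', hcd', hd', hinc, m, hm⟩ := exists_subinterval_of_two_le (x := x) hcd
      ((hθ n).mono hsub) ((hmono n).mono hsub) hρ hρ1 h2
    refine ⟨(c', d'), ⟨hc.trans hc', hcd', hd'.trans hd, ?_⟩, hc', hd', fun t ht => ⟨m, hm t ht⟩⟩
    have := hexp n c' (hsub ⟨hc', hcd'.trans hd'⟩) d' (hsub ⟨hc'.trans hcd', hd'⟩) hcd'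
    rw [hinc] at this
    change 2 ≤ θ (n + 1) d' - θ (n + 1) c'
    linarith
  choose! f hfP hfl hfr hfm using hstep
  let I : ℕ → ℝ × ℝ := fun k => Nat.rec (a, b) (fun k J => f (N + k) J) k
  have hI : ∀ k, P (N + k) (I k) := fun k => by
    induction k with
    | zero => exact ⟨le_rfl, hab, le_rfl, hN⟩
    | succ k ih => exact hfP _ _ ih
  have hnest : ∀ k, Icc (I (k + 1)).1 (I (k + 1)).2 ⊆ Icc (I k).1 (I k).2 := fun k =>
    Icc_subset_Icc (hfl _ _ (hI k)) (hfr _ _ (hI k))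
  obtain ⟨t, ht⟩ := IsCompact.nonempty_iInter_of_sequence_nonempty_isCompact_isClosed
    (fun k => Icc (I k).1 (I k).2) hnest (fun k => nonempty_Icc.2 (hI k).2.1) isCompact_Icc
    (fun k => isClosed_Icc)
  rw [mem_iInter] at ht
  refine ⟨t, ht 0, N, fun n hn => ?_⟩
  obtain ⟨k, rfl⟩ := Nat.exists_eq_add_of_le hn
  exact hfm _ _ (hI k) t (ht (k + 1))

/-! ### The unstable bundle of the skew product -/

/-- A backward orbit of the cocycle `(e, s) ↦ (α e, h (s + κ e))` that does not grow too fast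
lies in the cone `0 ≤ s ≤ C e`, provided that the expansion `α` dominates `2 h`. -/
theorem mem_cone_of_backward_orbit {e s h α κ : ℕ → ℝ} {l lam C K : ℝ}
    (he : ∀ n, e n = α n * e (n + 1)) (hs : ∀ n, s n = h n * (s (n + 1) + κ n * e (n + 1)))
    (hh : ∀ n, 0 ≤ h n ∧ h n ≤ l) (hκ : ∀ n, 0 ≤ κ n ∧ κ n ≤ C) (hα : ∀ n, 2 * l ≤ α n)
    (hl : 0 < l) (hlam : 0 ≤ lam) (hll : l * lam < 1) (hK : ∀ n, |s n| ≤ K * lam ^ n)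
    (he0 : 0 ≤ e 0) : 0 ≤ s 0 ∧ s 0 ≤ C * e 0 := by
  have hC : 0 ≤ C := (hκ 0).1.trans (hκ 0).2
  have hen : ∀ n, 0 ≤ e n := fun n => by
    induction n with
    | zero => exact he0
    | succ n ih =>
      rw [he n] at ih
      exact nonneg_of_mul_nonneg_right ih (by linarith [hα n])
  have hbound : ∀ n k, -(l ^ n * |s (k + n)|) ≤ s k ∧ s k ≤ C * e k + l ^ n * |s (k + n)| := by
    intro n
    induction n with
    | zero =>
      intro k
      have := mul_nonneg hC (hen k)
      simp only [pow_zero, one_mul, add_zero]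
      exact ⟨neg_abs_le _, by linarith [le_abs_self (s k)]⟩
    | succ n ih =>
      intro k
      obtain ⟨h1, h2⟩ := ih (k + 1)
      rw [show k + 1 + n = k + (n + 1) by ring] at h1 h2
      set X := l ^ n * |s (k + (n + 1))| with hX
      have hX0 : 0 ≤ X := by positivity
      rw [pow_succ', mul_assoc, ← hX, hs k, he k]
      have hke := mul_nonneg (hκ k).1 (hen (k + 1))
      have hke' := mul_le_mul_of_nonneg_right (hκ k).2 (hen (k + 1))
      have hCe := mul_nonneg hC (hen (k + 1))
      constructor
      · calc -(l * X) ≤ h k * -X := by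
              linarith [mul_le_mul_of_nonneg_right (hh k).2 hX0]
          _ ≤ _ := mul_le_mul_of_nonneg_left (by linarith) (hh k).1
      · calc h k * (s (k + 1) + κ k * e (k + 1))
            ≤ h k * (2 * (C * e (k + 1)) + X) :=
              mul_le_mul_of_nonneg_left (by linarith) (hh k).1
          _ ≤ l * (2 * (C * e (k + 1)) + X) :=
              mul_le_mul_of_nonneg_right (hh k).2 (by linarith)
          _ = 2 * l * (C * e (k + 1)) + l * X := by ring
          _ ≤ α k * (C * e (k + 1)) + l * X := by
              linarith [mul_le_mul_of_nonneg_right (hα k) hCe]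
          _ = _ := by ring
  have hlim : Tendsto (fun n => K * (l * lam) ^ n) atTop (𝓝 0) := by
    simpa using (tendsto_pow_atTop_nhds_zero_of_lt_one (by positivity) hll).const_mul K
  have hle : ∀ n, l ^ n * |s (0 + n)| ≤ K * (l * lam) ^ n := fun n => by
    rw [zero_add, mul_pow, mul_left_comm]
    exact mul_le_mul_of_nonneg_left (hK n) (by positivity)
  constructor
  · refine ge_of_tendsto' (x := atTop) (f := fun n => s 0 + K * (l * lam) ^ n)
      (by simpa using hlim.const_add (s 0)) fun n => ?_
    linarith [(hbound n 0).1, hle n]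
  · refine ge_of_tendsto' (x := atTop) (f := fun n => C * e 0 + K * (l * lam) ^ n)
      (by simpa using hlim.const_add (C * e 0)) fun n => ?_
    linarith [(hbound n 0).2, hle n]

/-- `v` has base component `a • d` and slope `v 2 / a` between `0` and `C`. -/
def InSlopeCone (C : ℝ) (d : Tan2) (a : ℝ) (v : Tan3) : Prop :=
  baseProj v = a • d ∧ ∃ σ, 0 ≤ σ ∧ σ ≤ C ∧ v 2 = a * σ

theorem InSlopeCone.coeff_ne_zero {C a : ℝ} {d : Tan2} {v : Tan3} (h : InSlopeCone C d a v)
    (hv : v ≠ 0) : a ≠ 0 := by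
  rintro rfl
  obtain ⟨h1, σ, -, -, h2⟩ := h
  apply hv
  rw [← baseIncl_add_smul_centerVec v, h1, h2]
  simp

theorem InSlopeCone.coord_zero {C a : ℝ} {d : Tan2} {v : Tan3} (h : InSlopeCone C d a v) :
    v 0 = a * d 0 := by
  rw [← baseProj_zero, h.1]
  simp

theorem coord_le_norm (d : Tan2) : d 0 ≤ ‖d‖ :=
  (le_abs_self _).trans (PiLp.norm_apply_le d 0)

section Cone

variable {A : Torus2 ≃ Torus2} {g r : UnitAddCircle ≃ UnitAddCircle}
  {Eu Es : Torus2 → Submodule ℝ Tan2} {du ds : Torus2 → Tan2} {αu αs : Torus2 → ℝ}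
  {lamA c C β l : ℝ}

theorem IsTransverseBase.coord_unique (hA : IsAnosov A lamA Eu Es)
    (hB : IsTransverseBase A Eu Es β du ds αu αs) {p : Torus2} {e f e' f' : ℝ}
    (h : e • du p + f • ds p = e' • du p + f' • ds p) : e = e' ∧ f = f' := by
  have h1 : (e - e') • du p = (f' - f) • ds p := by
    rw [sub_smul, sub_smul, sub_eq_sub_iff_add_eq_add, h, add_comm]
  have hu : (e - e') • du p ∈ Eu p := by
    rw [hB.span_du]
    exact Submodule.smul_mem _ _ (Submodule.mem_span_singleton_self _)
  have hs : (e - e') • du p ∈ Es p := by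
    rw [h1, hB.span_ds]
    exact Submodule.smul_mem _ _ (Submodule.mem_span_singleton_self _)
  have h0 := Submodule.disjoint_def.1 (hA.isCompl p).disjoint _ hs hu
  have h0' := h1 ▸ h0
  have hdu : du p ≠ 0 := norm_ne_zero_iff.1 (by rw [hB.norm_du]; exact one_ne_zero)
  have hds : ds p ≠ 0 := norm_ne_zero_iff.1 (by rw [hB.norm_ds]; exact one_ne_zero)
  have h2 := (smul_eq_zero.1 h0).resolve_right hdu
  have h3 := (smul_eq_zero.1 h0').resolve_right hds
  exact ⟨by linarith, by linarith⟩

theorem IsTransverseBase.exists_coord (hA : IsAnosov A lamA Eu Es)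
    (hB : IsTransverseBase A Eu Es β du ds αu αs) (p : Torus2) (w : Tan2) :
    ∃ e f : ℝ, w = e • du p + f • ds p := by
  have hw : w ∈ Es p ⊔ Eu p := by rw [(hA.isCompl p).sup_eq_top]; trivial
  obtain ⟨y, hy, z, hz, rfl⟩ := Submodule.mem_sup.1 hw
  rw [hB.span_ds] at hy
  rw [hB.span_du] at hz
  obtain ⟨f, rfl⟩ := Submodule.mem_span_singleton.1 hy
  obtain ⟨e, rfl⟩ := Submodule.mem_span_singleton.1 hz
  exact ⟨e, f, add_comm _ _⟩

theorem IsTransverseBase.deriv2_coord (hB : IsTransverseBase A Eu Es β du ds αu αs) (p : Torus2)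
    (e f : ℝ) : deriv2 A p (e • du p + f • ds p) =
      (αu p * e) • du (A p) + (αs p * f) • ds (A p) := by
  rw [map_add, map_smul, map_smul, hB.map_du, hB.map_ds, smul_smul, smul_smul, mul_comm e,
    mul_comm f]

theorem IsTransverseBase.stable_coeff_le (hA : IsAnosov A lamA Eu Es)
    (hB : IsTransverseBase A Eu Es β du ds αu αs) (p : Torus2) : αs p ≤ lamA := by
  have h := hA.stable p (ds p) (by rw [hB.span_ds]; exact Submodule.mem_span_singleton_self _)
  rwa [hB.map_ds, norm_smul, hB.norm_ds, hB.norm_ds, mul_one, mul_one, Real.norm_eq_abs,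
    abs_of_pos (hB.αs_pos p)] at h

theorem skewDeriv_injective (hA : IsAnosov A lamA Eu Es)
    (hB : IsTransverseBase A Eu Es β du ds αu αs) (hg : ∀ z, 0 < circleDeriv g z) (p : Torus3) :
    Function.Injective (skewDeriv A g r p) := by
  rw [injective_iff_map_eq_zero]
  intro v hv
  obtain ⟨e, f, hw⟩ := hB.exists_coord hA p.1 (baseProj v)
  have h1 : deriv2 A p.1 (baseProj v) = 0 := by
    rw [← baseProj_skewLinear, ← skewDeriv, hv, map_zero]
  rw [hw, hB.deriv2_coord] at h1
  obtain ⟨he, hf⟩ := hB.coord_unique hA (e' := 0) (f' := 0) (h1.trans (by simp))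
  have he' := (mul_eq_zero.1 he).resolve_left (hB.αu_pos _).ne'
  have hf' := (mul_eq_zero.1 hf).resolve_left (hB.αs_pos _).ne'
  have hw0 : baseProj v = 0 := by rw [hw, he', hf']; simp
  have hv0 : v 0 = 0 := by rw [← baseProj_zero, hw0]; rfl
  have h2 : skewDeriv A g r p v 2 = 0 := by rw [hv]; rfl
  rw [skewDeriv, skewLinear_two, hv0, mul_zero, add_zero] at h2
  have hv2 := (mul_eq_zero.1 h2).resolve_left (hg _).ne'
  rw [← baseIncl_add_smul_centerVec v, hw0, hv2]
  simp

/-- Forward invariance of the slope cones. -/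
theorem InSlopeCone.map_skewDeriv (hB : IsTransverseBase A Eu Es β du ds αu αs) (hβ : 0 < β)
    (hc : 0 < c) (hr : IsMonotoneRotation r c C) (hg : ∀ z, 0 < circleDeriv g z)
    (hgl : ∀ z, circleDeriv g z ≤ l) (hα : ∀ p, 2 * l ≤ αu p) {p : Torus3} {a : ℝ} {v : Tan3}
    (h : InSlopeCone C (du p.1) a v) :
    InSlopeCone C (du (A p.1)) (αu p.1 * a) (skewDeriv A g r p v) := by
  have h0 := h.coord_zero
  obtain ⟨h1, σ, hσ0, hσC, h2⟩ := h
  set h' := circleDeriv g (p.2 + r p.1.1) with hh'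
  have hκ0 : 0 ≤ circleDeriv r p.1.1 := hc.le.trans (hr.lower _)
  have hd0 : 0 ≤ du p.1 0 := hβ.le.trans (hB.du_x _)
  have hd1 : du p.1 0 ≤ 1 := hB.norm_du p.1 ▸ coord_le_norm _
  have hκ : circleDeriv r p.1.1 * du p.1 0 ≤ C :=
    (mul_le_of_le_one_right hκ0 hd1).trans (hr.upper _)
  have hκ' : 0 ≤ circleDeriv r p.1.1 * du p.1 0 := mul_nonneg hκ0 hd0
  have hαp := hB.αu_pos p.1
  refine ⟨?_, h' * (σ + circleDeriv r p.1.1 * du p.1 0) / αu p.1, ?_, ?_, ?_⟩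
  · rw [skewDeriv, baseProj_skewLinear, h1, map_smul, hB.map_du, smul_smul, mul_comm]
  · exact div_nonneg (mul_nonneg (hg _).le (by linarith)) hαp.le
  · rw [div_le_iff₀ hαp]
    calc h' * (σ + circleDeriv r p.1.1 * du p.1 0) ≤ l * (2 * C) :=
          mul_le_mul (hgl _) (by linarith) (by linarith) ((hg 0).le.trans (hgl 0))
      _ = C * (2 * l) := by ring
      _ ≤ C * αu p.1 := mul_le_mul_of_nonneg_left (hα _) (by linarith)
  · rw [skewDeriv, skewLinear_two, h2, h0, ← hh']
    field_simp

/-- A vector in the cone at `p` moves the lift of `z + r x` at a rate comparable to its base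
component. -/
theorem InSlopeCone.exists_rate (hB : IsTransverseBase A Eu Es β du ds αu αs) (hβ : 0 < β)
    (hc : 0 < c) (hr : IsMonotoneRotation r c C) {p : Torus3} {a : ℝ} {v : Tan3}
    (h : InSlopeCone C (du p.1) a v) :
    ∃ ω, c * β ≤ ω ∧ ω ≤ 2 * C ∧ v 2 + circleDeriv r p.1.1 * v 0 = a * ω := by
  have h0 := h.coord_zero
  obtain ⟨h1, σ, hσ0, hσC, h2⟩ := h
  have hκ0 : 0 ≤ circleDeriv r p.1.1 := hc.le.trans (hr.lower _)
  have hd1 : du p.1 0 ≤ 1 := hB.norm_du p.1 ▸ coord_le_norm _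
  refine ⟨σ + circleDeriv r p.1.1 * du p.1 0, ?_, ?_, ?_⟩
  · have := mul_le_mul (hr.lower p.1.1) (hB.du_x p.1) hβ.le hκ0
    linarith
  · have := (mul_le_of_le_one_right hκ0 hd1).trans (hr.upper _)
    linarith
  · rw [h2, h0]; ring

/-- The backward iterates of an unstable vector form a backward orbit of the differential. -/
theorem skewDeriv_deriv3_symm_iterate (hA : IsAnosov A lamA Eu Es)
    (hB : IsTransverseBase A Eu Es β du ds αu αs) (hgc : TorusC2 proj1 proj1 g)
    (hg : ∀ z, 0 < circleDeriv g z) (hr : TorusC2 proj1 proj1 r) (p : Torus3) (v : Tan3) (n : ℕ) :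
    skewDeriv A g r ((skewProduct A g r).symm^[n + 1] p)
      (deriv3 (skewProduct A g r).symm^[n + 1] p v) =
        deriv3 (skewProduct A g r).symm^[n] p v := by
  have hex := exists_hasTorusDerivAt_iterate proj3_add proj3_surjective
    (exists_hasTorusDerivAt_skewProduct_symm hA.c2 hgc hr (skewDeriv_injective hA hB hg))
  obtain ⟨L, hL⟩ := hex (n + 1) p
  have hcomp := (hasTorusDerivAt_skewProduct hA.c2 hgc hr
    ((skewProduct A g r).symm^[n + 1] p)).comp proj3_add proj3_add hL
  have hf : ⇑(skewProduct A g r) ∘ (skewProduct A g r).symm^[n + 1] =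
      (skewProduct A g r).symm^[n] := by
    rw [Function.iterate_succ']
    ext1 x
    simp
  rw [hf] at hcomp
  rw [deriv3, deriv3, hL.torusDeriv_eq proj3_add eventually_proj3_eq_zero_imp,
    hcomp.torusDeriv_eq proj3_add eventually_proj3_eq_zero_imp]
  rfl

/-- The unstable space lies in the slope cone: backward contraction excludes a stable component
in the base and, by domination, a slope outside `[0, C]`. -/
theorem exists_inSlopeCone_of_mem_unstableSpace (hA : IsAnosov A lamA Eu Es)
    (hB : IsTransverseBase A Eu Es β du ds αu αs) (hβ : 0 < β) (hc : 0 < c)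
    (hr : IsMonotoneRotation r c C) (hgc : TorusC2 proj1 proj1 g)
    (hg : ∀ z, 0 < circleDeriv g z) (hgl : ∀ z, circleDeriv g z ≤ l) (hα : ∀ p, 2 * l ≤ αu p)
    (hl : 1 < l) (hlam : 0 < lamA) (hll : l * lamA < 1) {p : Torus3} {v : Tan3}
    (hv : v ∈ unstableSpace (skewProduct A g r) lamA p) :
    ∃ a, InSlopeCone C (du p.1) a v := by
  obtain ⟨K, hK⟩ := hv
  set q : ℕ → Torus3 := fun n => (skewProduct A g r).symm^[n] p with hq
  set V : ℕ → Tan3 := fun n => deriv3 (skewProduct A g r).symm^[n] p v with hV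
  have hVK : ∀ n, ‖V n‖ ≤ K * lamA ^ n := hK
  have hVrec : ∀ n, skewDeriv A g r (q (n + 1)) (V (n + 1)) = V n :=
    skewDeriv_deriv3_symm_iterate hA hB hgc hg hr.c2 p v
  have hV0 : V 0 = v := by
    obtain ⟨x, rfl⟩ := proj3_surjective p
    have h : HasTorusDerivAt proj3 proj3 (skewProduct A g r).symm^[0]
        (ContinuousLinearMap.id ℝ Tan3) (proj3 x) :=
      .of_lift (Φ := id) proj3_add (fun _ => rfl) (hasFDerivAt_id x)
    rw [hV]
    simp only
    rw [deriv3, h.torusDeriv_eq proj3_add eventually_proj3_eq_zero_imp]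
    rfl
  have hqA : ∀ n, A (q (n + 1)).1 = (q n).1 := fun n => by
    have : skewProduct A g r (q (n + 1)) = q n := by
      simp only [hq, Function.iterate_succ_apply', Equiv.apply_symm_apply]
    rw [← this]
    rfl
  choose e f hef using fun n => hB.exists_coord hA (q n).1 (baseProj (V n))
  have hrec : ∀ n, e n = αu (q (n + 1)).1 * e (n + 1) ∧ f n = αs (q (n + 1)).1 * f (n + 1) :=
    fun n => by
      apply hB.coord_unique hA (p := (q n).1)
      rw [← hef n, ← hVrec n, skewDeriv, baseProj_skewLinear, hef (n + 1), hB.deriv2_coord, hqA]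
  have hK0 : 0 ≤ K := (norm_nonneg _).trans (by simpa using hVK 0)
  have hlam1 := hA.lam_lt_one
  -- The stable coefficients are bounded, and contract under forward iteration, so they vanish.
  have he_le : ∀ n, |e n| ≤ |e 0| := fun n => by
    induction n with
    | zero => exact le_rfl
    | succ n ih =>
      refine le_trans ?_ ih
      rw [(hrec n).1, abs_mul, abs_of_pos (hB.αu_pos _)]
      exact le_mul_of_one_le_left (abs_nonneg _) (by linarith [hα (q (n + 1)).1])
  have hf_bdd : ∀ n, |f n| ≤ K + |e 0| := fun n => by
    have h1 : f n • ds (q n).1 = baseProj (V n) - e n • du (q n).1 := by rw [hef n]; abel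
    have h2 := norm_sub_le (baseProj (V n)) (e n • du (q n).1)
    rw [← h1, norm_smul, norm_smul, hB.norm_ds, hB.norm_du, mul_one, mul_one, Real.norm_eq_abs,
      Real.norm_eq_abs] at h2
    have h3 := (norm_baseProj_le (V n)).trans (hVK n)
    have h4 : K * lamA ^ n ≤ K := mul_le_of_le_one_right hK0 (pow_le_one₀ hlam.le hlam1.le)
    linarith [he_le n]
  have hf_pow : ∀ k n, |f n| ≤ lamA ^ k * |f (n + k)| := fun k => by
    induction k with
    | zero => simp
    | succ k ih =>
      intro n
      have h1 := ih (n + 1)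
      rw [show n + 1 + k = n + (k + 1) by ring] at h1
      rw [(hrec n).2, abs_mul, abs_of_pos (hB.αs_pos _), pow_succ', mul_assoc]
      exact mul_le_mul (hB.stable_coeff_le hA _) h1 (abs_nonneg _) hlam.le
  have hf0 : ∀ n, f n = 0 := fun n => by
    have hlim : Tendsto (fun k => lamA ^ k * (K + |e 0|)) atTop (𝓝 0) := by
      simpa using (tendsto_pow_atTop_nhds_zero_of_lt_one hlam.le hlam1).mul_const (K + |e 0|)
    have h := ge_of_tendsto' hlim fun k => (hf_pow k n).trans
      (mul_le_mul_of_nonneg_left (hf_bdd _) (by positivity))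
    exact abs_nonpos_iff.1 h
  have hbase : ∀ n, baseProj (V n) = e n • du (q n).1 := fun n => by
    rw [hef n, hf0 n, zero_smul, add_zero]
  set κ : ℕ → ℝ := fun n => circleDeriv r (q (n + 1)).1.1 * du (q (n + 1)).1 0 with hκdef
  have hκ : ∀ n, 0 ≤ κ n ∧ κ n ≤ C := fun n => by
    have hκ0 : 0 ≤ circleDeriv r (q (n + 1)).1.1 := hc.le.trans (hr.lower _)
    exact ⟨mul_nonneg hκ0 (hβ.le.trans (hB.du_x _)), (mul_le_of_le_one_right hκ0
      (hB.norm_du (q (n + 1)).1 ▸ coord_le_norm _)).trans (hr.upper _)⟩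
  set h : ℕ → ℝ := fun n => circleDeriv g ((q (n + 1)).2 + r (q (n + 1)).1.1)
  have hs : ∀ n, V n 2 = h n * (V (n + 1) 2 + κ n * e (n + 1)) := fun n => by
    have h0 : V (n + 1) 0 = e (n + 1) * du (q (n + 1)).1 0 := by
      rw [← baseProj_zero, hbase]; simp
    rw [← hVrec n, skewDeriv, skewLinear_two, h0, hκdef]
    ring
  have hsK : ∀ n, |V n 2| ≤ K * lamA ^ n := fun n => (PiLp.norm_apply_le (V n) 2).trans (hVK n)
  have hh : ∀ n, 0 ≤ h n ∧ h n ≤ l := fun n => ⟨(hg _).le, hgl _⟩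
  refine ⟨e 0, by rw [← hV0]; exact hbase 0, V 0 2 / e 0, ?_⟩
  rw [← hV0]
  rcases le_total 0 (e 0) with he0 | he0
  · obtain ⟨h1, h2⟩ := mem_cone_of_backward_orbit (fun n => (hrec n).1) hs hh hκ
      (fun n => hα _) (by linarith) hlam.le hll hsK he0
    refine ⟨div_nonneg h1 he0, div_le_of_le_mul₀ he0 ((hκ 0).1.trans (hκ 0).2) h2, ?_⟩
    rcases eq_or_ne (e 0) 0 with h0 | h0
    · rw [h0, mul_zero] at h2
      rw [h0, zero_mul]
      exact le_antisymm h2 h1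
    · exact (mul_div_cancel₀ _ h0).symm
  · obtain ⟨h1, h2⟩ := mem_cone_of_backward_orbit (e := fun n => -e n) (s := fun n => -V n 2)
      (fun n => by rw [mul_neg, ← (hrec n).1]) (fun n => by rw [hs n]; ring) hh hκ
      (fun n => hα _) (by linarith) hlam.le hll (fun n => by rw [abs_neg]; exact hsK n)
      (neg_nonneg.2 he0)
    rw [← neg_div_neg_eq]
    refine ⟨div_nonneg h1 (neg_nonneg.2 he0),
      div_le_of_le_mul₀ (neg_nonneg.2 he0) ((hκ 0).1.trans (hκ 0).2) h2, ?_⟩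
    rcases eq_or_ne (e 0) 0 with h0 | h0
    · rw [h0, neg_zero, mul_zero] at h2
      rw [h0, zero_mul]
      linarith
    · rw [neg_div_neg_eq, mul_div_cancel₀ _ h0]

end Cone

/-! ### Unstable curves -/

theorem sub_le_sub_of_hasDerivWithinAt_le {f f' h h' : ℝ → ℝ} {a b : ℝ}
    (hf : ∀ t ∈ Icc a b, HasDerivWithinAt f (f' t) (Icc a b) t)
    (hh : ∀ t ∈ Icc a b, HasDerivWithinAt h (h' t) (Icc a b) t)
    (hle : ∀ t ∈ Icc a b, f' t ≤ h' t) {s t : ℝ} (hs : s ∈ Icc a b) (ht : t ∈ Icc a b)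
    (hst : s ≤ t) : f t - f s ≤ h t - h s := by
  have hd : ∀ u ∈ Icc a b, HasDerivWithinAt (fun u => h u - f u) (h' u - f' u) (Icc a b) u :=
    fun u hu => (hh u hu).sub (hf u hu)
  have hm : MonotoneOn (fun u => h u - f u) (Icc a b) := by
    refine monotoneOn_of_hasDerivWithinAt_nonneg (f' := fun u => h' u - f' u) (convex_Icc a b)
      (fun u hu => (hd u hu).continuousWithinAt)
      (fun u hu => (hd u (interior_subset hu)).mono interior_subset)
      (fun u hu => sub_nonneg.2 (hle u (interior_subset hu)))
  have := hm hs ht hst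
  simp only at this
  linarith

theorem exists_sign_of_ne_zero {f : ℝ → ℝ} {a b : ℝ} (hf : ContinuousOn f (Icc a b))
    (h0 : ∀ t ∈ Icc a b, f t ≠ 0) : ∃ ε : ℝ, (ε = 1 ∨ ε = -1) ∧ ∀ t ∈ Icc a b, 0 < ε * f t := by
  by_cases hpos : ∀ t ∈ Icc a b, 0 < f t
  · exact ⟨1, Or.inl rfl, fun t ht => by simpa using hpos t ht⟩
  push Not at hpos
  obtain ⟨s, hs, hfs⟩ := hpos
  refine ⟨-1, Or.inr rfl, fun t ht => ?_⟩
  by_contra! hneg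
  obtain ⟨u, hu, hu0⟩ := isPreconnected_Icc.intermediate_value hs ht hf
    (show (0 : ℝ) ∈ Icc (f s) (f t) from ⟨hfs, by linarith⟩)
  exact h0 u hu hu0

section Curves

variable {A : Torus2 ≃ Torus2} {g r : UnitAddCircle ≃ UnitAddCircle}
  {Eu Es : Torus2 → Submodule ℝ Tan2} {du ds : Torus2 → Tan2} {αu αs : Torus2 → ℝ}
  {lamA c C β l M : ℝ}

/-- Along an unstable curve the lifts of `z + r x` at successive times form an expanding sequence,
so some point of the curve has `z + r x` within `ρ` of any prescribed point at all large times. -/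
theorem exists_orbit_near (hA : IsAnosov A lamA Eu Es)
    (hB : IsTransverseBase A Eu Es β du ds αu αs) (hβ : 0 < β) (hc : 0 < c)
    (hr : IsMonotoneRotation r c C) (hgc : TorusC2 proj1 proj1 g)
    (hg : ∀ z, 0 < circleDeriv g z) (hgl : ∀ z, circleDeriv g z ≤ l) (hα : ∀ p, 2 * l ≤ αu p)
    (hl : 1 < l) (hlam : 0 < lamA) (hll : l * lamA < 1) (hαM : ∀ p, M * (2 * C) ≤ αu p * (c * β))
    {ρ : ℝ} (hρ : 0 < ρ) (hρ1 : ρ ≤ 1 / 2) (hMρ : 1 ≤ M * ρ)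
    {γ γ' : ℝ → Tan3} {a b : ℝ} (hab : a < b)
    (hγ : ∀ t ∈ Icc a b, HasDerivWithinAt γ (γ' t) (Icc a b) t) (hγ' : ContinuousOn γ' (Icc a b))
    (hne : ∀ t ∈ Icc a b, γ' t ≠ 0)
    (htan : ∀ t ∈ Icc a b, γ' t ∈ unstableSpace (skewProduct A g r) lamA (proj3 (γ t))) (x : ℝ) :
    ∃ t ∈ Icc a b, ∃ N, ∀ n ≥ N, ∃ τ : ℝ, |τ - x| ≤ ρ ∧
      ((skewProduct A g r)^[n] (proj3 (γ t))).2 +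
        r ((skewProduct A g r)^[n] (proj3 (γ t))).1.1 = proj1 τ := by
  obtain ⟨Φ, -, hΦ, hΦd⟩ := exists_skewLift hA.c2 hgc hr.c2
  obtain ⟨R, hRc, hR⟩ := hr.c2
  set F := skewProduct A g r with hF
  have hM : 0 < M := pos_of_mul_pos_left (by linarith) hρ.le
  set Γ : ℕ → ℝ → Tan3 := fun n t => Φ^[n] (γ t) with hΓ
  have hΓproj : ∀ n t, proj3 (Γ n t) = F^[n] (proj3 (γ t)) := fun n t => by
    induction n with
    | zero => rfl
    | succ n ih => simp only [hΓ, Function.iterate_succ_apply', hΦ] at ih ⊢; rw [ih]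
  let V : ℕ → ℝ → Tan3 := fun n => Nat.rec γ' (fun n W t => skewDeriv A g r (proj3 (Γ n t)) (W t)) n
  have hV : ∀ n t, V (n + 1) t = skewDeriv A g r (proj3 (Γ n t)) (V n t) := fun _ _ => rfl
  have hΓd : ∀ n, ∀ t ∈ Icc a b, HasDerivWithinAt (Γ n) (V n t) (Icc a b) t := fun n => by
    induction n with
    | zero => exact hγ
    | succ n ih =>
      intro t ht
      have h := (hΦd (Γ n t)).comp_hasDerivWithinAt t (ih t ht)
      have hfun : Γ (n + 1) = Φ ∘ Γ n := by
        ext1 s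
        exact Function.iterate_succ_apply' Φ n (γ s)
      rw [hfun, hV]
      exact h
  set θ : ℕ → ℝ → ℝ := fun n t => Γ n t 2 + R (Γ n t 0) with hθ
  set ϑ : ℕ → ℝ → ℝ := fun n t =>
    V n t 2 + circleDeriv r (proj3 (Γ n t)).1.1 * V n t 0 with hϑ
  have hθd : ∀ n, ∀ t ∈ Icc a b, HasDerivWithinAt (θ n) (ϑ n t) (Icc a b) t := fun n t ht => by
    have h (i : Fin 3) : HasDerivWithinAt (fun t => Γ n t i) (V n t i) (Icc a b) t :=
      (EuclideanSpace.proj (𝕜 := ℝ) i).hasFDerivAt.comp_hasDerivWithinAt t (hΓd n t ht)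
    exact (h 2).add ((hasDerivAt_circleDeriv hRc hR (Γ n t 0)).comp_hasDerivWithinAt t (h 0))
  have hθproj : ∀ n t, (F^[n] (proj3 (γ t))).2 + r (F^[n] (proj3 (γ t))).1.1 = proj1 (θ n t) :=
    fun n t => by
      rw [← hΓproj, hθ]
      simp only [proj1_add, hR]
      rfl
  -- The base component of the tangent has constant sign.
  have hcone0 : ∀ t ∈ Icc a b, ∃ e, InSlopeCone C (du (proj3 (γ t)).1) e (γ' t) := fun t ht =>
    exists_inSlopeCone_of_mem_unstableSpace hA hB hβ hc hr hgc hg hgl hα hl hlam hll (htan t ht)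
  obtain ⟨ε, hε, hεpos⟩ : ∃ ε : ℝ, (ε = 1 ∨ ε = -1) ∧ ∀ t ∈ Icc a b, 0 < ε * γ' t 0 := by
    refine exists_sign_of_ne_zero ?_ fun t ht => ?_
    · exact (EuclideanSpace.proj (𝕜 := ℝ) (0 : Fin 3)).continuous.comp_continuousOn hγ'
    · obtain ⟨e, he⟩ := hcone0 t ht
      rw [he.coord_zero]
      exact mul_ne_zero (he.coeff_ne_zero (hne t ht)) (hβ.trans_le (hB.du_x _)).ne'
  have hεε : ε * ε = 1 := by rcases hε with rfl | rfl <;> norm_num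
  have hcone : ∀ n, ∀ t ∈ Icc a b,
      ∃ e, 0 < ε * e ∧ InSlopeCone C (du (proj3 (Γ n t)).1) e (V n t) := fun n => by
    induction n with
    | zero =>
      intro t ht
      obtain ⟨e, he⟩ := hcone0 t ht
      have h := hεpos t ht
      rw [he.coord_zero, ← mul_assoc] at h
      exact ⟨e, pos_of_mul_pos_left h (hβ.le.trans (hB.du_x _)), he⟩
    | succ n ih =>
      intro t ht
      obtain ⟨e, he0, he⟩ := ih t ht
      refine ⟨αu (proj3 (Γ n t)).1 * e, ?_, ?_⟩
      · rw [mul_left_comm]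
        exact mul_pos (hB.αu_pos _) he0
      · have hp : (proj3 (Γ (n + 1) t)).1 = A (proj3 (Γ n t)).1 := by
          rw [hΓproj, hΓproj, Function.iterate_succ_apply']
          rfl
        rw [hV, hp]
        exact he.map_skewDeriv hB hβ hc hr hg hgl hα
  have hϑpos : ∀ n, ∀ t ∈ Icc a b, 0 < ε * ϑ n t := fun n t ht => by
    obtain ⟨e, he0, he⟩ := hcone n t ht
    obtain ⟨ω, hω, -, h⟩ := he.exists_rate hB hβ hc hr
    change 0 < ε * (_ + _)
    rw [h, ← mul_assoc]
    exact mul_pos he0 ((mul_pos hc hβ).trans_le hω)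
  have hϑexp : ∀ n, ∀ t ∈ Icc a b, M * (ε * ϑ n t) ≤ ε * ϑ (n + 1) t := fun n t ht => by
    obtain ⟨e, he0, he⟩ := hcone n t ht
    obtain ⟨ω, -, hω, h⟩ := he.exists_rate hB hβ hc hr
    have hp : (proj3 (Γ (n + 1) t)).1 = A (proj3 (Γ n t)).1 := by
      rw [hΓproj, hΓproj, Function.iterate_succ_apply']
      rfl
    have he' : InSlopeCone C (du (proj3 (Γ (n + 1) t)).1) (αu (proj3 (Γ n t)).1 * e)
        (V (n + 1) t) := by
      rw [hV, hp]
      exact he.map_skewDeriv hB hβ hc hr hg hgl hα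
    obtain ⟨ω', hω', -, h'⟩ := he'.exists_rate hB hβ hc hr
    change M * (ε * (_ + _)) ≤ ε * (_ + _)
    rw [h, h']
    have h1 : M * ω ≤ αu (proj3 (Γ n t)).1 * ω' :=
      (mul_le_mul_of_nonneg_left hω hM.le).trans ((hαM _).trans
        (mul_le_mul_of_nonneg_left hω' (hB.αu_pos _).le))
    calc M * (ε * (e * ω)) = ε * e * (M * ω) := by ring
      _ ≤ ε * e * (αu (proj3 (Γ n t)).1 * ω') := mul_le_mul_of_nonneg_left h1 he0.le
      _ = _ := by ring
  have hεd : ∀ n, ∀ t ∈ Icc a b,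
      HasDerivWithinAt (fun t => ε * θ n t) (ε * ϑ n t) (Icc a b) t :=
    fun n t ht => (hθd n t ht).const_mul ε
  have hcont : ∀ n, ContinuousOn (fun t => ε * θ n t) (Icc a b) := fun n t ht =>
    (hεd n t ht).continuousWithinAt
  have hstrict : ∀ n, StrictMonoOn (fun t => ε * θ n t) (Icc a b) := fun n =>
    strictMonoOn_of_hasDerivWithinAt_pos (f' := fun u => ε * ϑ n u) (convex_Icc a b) (hcont n)
      (fun u hu => (hεd n u (interior_subset hu)).mono interior_subset)
      (fun u hu => hϑpos n u (interior_subset hu))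
  obtain ⟨t, ht, N, hN⟩ := exists_forall_near_of_expanding (θ := fun n t => ε * θ n t) (x := ε * x)
    hab.le hcont (fun n => (hstrict n).monotoneOn)
    (fun n s hs t ht hst => by
      rw [mul_sub]
      exact sub_le_sub_of_hasDerivWithinAt_le (fun u hu => (hεd n u hu).const_mul M)
        (hεd (n + 1)) (hϑexp n) hs ht hst)
    (hstrict 0 (left_mem_Icc.2 hab.le) (right_mem_Icc.2 hab.le) hab) hρ hρ1 hMρ
  refine ⟨t, ht, N, fun n hn => ?_⟩
  obtain ⟨m, hm⟩ := hN n hn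
  have hint : ∃ k : ℤ, (k : ℝ) = ε * m := by
    rcases hε with rfl | rfl
    · exact ⟨m, by simp⟩
    · exact ⟨-m, by simp⟩
  obtain ⟨k, hk⟩ := hint
  refine ⟨θ n t - k, ?_, ?_⟩
  · have habs : |ε| = 1 := by rcases hε with rfl | rfl <;> simp
    have : ε * θ n t - ε * x - m = ε * (θ n t - k - x) := by
      rw [hk]
      linear_combination (m : ℝ) * hεε
    rwa [this, abs_mul, habs, one_mul] at hm
  · rw [hθproj]
    have : proj1 (k : ℝ) = 0 := (proj1_eq_zero_iff _).2 ⟨k, rfl⟩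
    conv_lhs => rw [← sub_add_cancel (θ n t) (k : ℝ), proj1_add, this, add_zero]

/-- The points of `exists_orbit_near` are dense in every unstable segment, as each subsegment
contains one. -/
theorem IsUnstableSegment.subset_closure (hA : IsAnosov A lamA Eu Es)
    (hB : IsTransverseBase A Eu Es β du ds αu αs) (hβ : 0 < β) (hc : 0 < c)
    (hr : IsMonotoneRotation r c C) (hgc : TorusC2 proj1 proj1 g)
    (hg : ∀ z, 0 < circleDeriv g z) (hgl : ∀ z, circleDeriv g z ≤ l) (hα : ∀ p, 2 * l ≤ αu p)
    (hl : 1 < l) (hlam : 0 < lamA) (hll : l * lamA < 1) (hαM : ∀ p, M * (2 * C) ≤ αu p * (c * β))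
    {ρ : ℝ} (hρ : 0 < ρ) (hρ1 : ρ ≤ 1 / 2) (hMρ : 1 ≤ M * ρ)
    {W : Set Torus3} (hW : IsUnstableSegment (skewProduct A g r) lamA W) (x : ℝ) :
    W ⊆ closure {p | p ∈ W ∧ ∃ N, ∀ n ≥ N, ∃ τ : ℝ, |τ - x| ≤ ρ ∧
      ((skewProduct A g r)^[n] p).2 + r ((skewProduct A g r)^[n] p).1.1 = proj1 τ} := by
  obtain ⟨a, b, γ, hab, hγ, htan, rfl⟩ := hW
  rintro _ ⟨t, ht, rfl⟩
  rw [mem_closure_iff_nhds]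
  intro U hU
  have hcont : ContinuousWithinAt (fun t => proj3 (γ t)) (Icc a b) t :=
    (continuous_proj3.comp_continuousOn hγ.continuousOn) t ht
  obtain ⟨δ, hδ, hball⟩ := Metric.mem_nhdsWithin_iff.1 (hcont hU)
  -- A nondegenerate interval near `t` inside `[a, b]`.
  obtain ⟨a', b', ha, hab', hb, hsub⟩ : ∃ a' b', a ≤ a' ∧ a' < b' ∧ b' ≤ b ∧
      Icc a' b' ⊆ Metric.ball t δ := by
    refine ⟨max a (t - δ / 2), min b (t + δ / 2), le_max_left _ _, ?_, min_le_left _ _, ?_⟩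
    · refine max_lt (lt_min hab ?_) (lt_min ?_ ?_) <;> linarith [ht.1, ht.2]
    · intro s hs
      rw [Metric.mem_ball, Real.dist_eq, abs_lt]
      have h1 := (le_max_right _ _).trans hs.1
      have h2 := hs.2.trans (min_le_right _ _)
      constructor <;> linarith
  have hI : Icc a' b' ⊆ Icc a b := Icc_subset_Icc ha hb
  obtain ⟨s, hs, hN⟩ := exists_orbit_near hA hB hβ hc hr hgc hg hgl hα hl hlam hll hαM hρ hρ1 hMρ
    (γ := γ) (γ' := derivWithin γ (Icc a b)) hab'
    (fun u hu => ((hγ.differentiableOn (by norm_num) u (hI hu)).hasDerivWithinAt).mono hI)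
    ((hγ.continuousOn_derivWithin (uniqueDiffOn_Icc hab) le_rfl).mono hI)
    (fun u hu => (htan u (hI hu)).1) (fun u hu => (htan u (hI hu)).2) x
  exact ⟨proj3 (γ s), hball ⟨hsub hs, hI hs⟩, ⟨s, hI hs, rfl⟩, hN⟩

end Curves

/-! ### Points with a center exponent of prescribed sign -/

theorem proposition4p3
    (g : UnitAddCircle ≃ UnitAddCircle) (zr za : UnitAddCircle) (hg : IsGradientLike g zr za)
    (c C β : ℝ) (hc : 0 < c) (hC : 0 < C) (hβ : 0 < β) :
    ∃ α₀ : ℝ, ∀ (A : Torus2 ≃ Torus2) (lamA : ℝ) (Eu Es : Torus2 → Submodule ℝ Tan2)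
      (r : UnitAddCircle ≃ UnitAddCircle) (du ds : Torus2 → Tan2) (αu αs : Torus2 → ℝ),
      IsAnosov A lamA Eu Es →
      IsDominated lamA g zr za →
      IsMonotoneRotation r c C →
      IsTransverseBase A Eu Es β du ds αu αs →
      α₀ ≤ ⨅ p, αu p →
      ∀ W : Set Torus3, IsUnstableSegment (skewProduct A g r) lamA W →
        W ⊆ closure {p | p ∈ W ∧
          0 < liminf (fun n : ℕ => centerExponent (skewProduct A g r) p n) atTop} ∧
        W ⊆ closure {p | p ∈ W ∧
          limsup (fun n : ℕ => centerExponent (skewProduct A g r) p n) atTop < 0} := by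
  by_cases hdom : circleDeriv g za < 1 ∧ 1 < circleDeriv g zr
  swap
  · exact ⟨0, fun A lamA Eu Es r du ds αu αs _ hD => absurd ⟨hD.min_lt_one, hD.one_lt_max⟩ hdom⟩
  obtain ⟨hmin, hmax⟩ := hdom
  obtain ⟨G, hGc, hG⟩ := hg.c2
  have hderiv : deriv G = fun t => circleDeriv g (proj1 t) :=
    funext fun t => (hasDerivAt_circleDeriv hGc hG t).deriv
  have hcont : Continuous fun t => circleDeriv g (proj1 t) :=
    hderiv ▸ hGc.continuous_deriv (by norm_num)
  obtain ⟨tr, rfl⟩ := proj1_surjective zr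
  obtain ⟨ta, rfl⟩ := proj1_surjective za
  obtain ⟨μ, hμ1, hμ⟩ := exists_between hmax
  obtain ⟨ν, hν, hν1⟩ := exists_between hmin
  obtain ⟨δ₁, hδ₁, hr1⟩ := Metric.eventually_nhds_iff.1
    (hcont.continuousAt.eventually_const_lt hμ)
  obtain ⟨δ₂, hδ₂, ha1⟩ := Metric.eventually_nhds_iff.1
    (hcont.continuousAt.eventually_lt_const hν)
  obtain ⟨ρ, hρ0, hρlt⟩ := exists_between (show 0 < min (1 / 2) (min δ₁ δ₂) by positivity)
  obtain ⟨hρh, hρ₁, hρ₂⟩ : ρ < 1 / 2 ∧ ρ < δ₁ ∧ ρ < δ₂ := by simpa using hρlt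
  -- The first term keeps the slope cones invariant, the second makes `z + r x` expand by the
  -- factor `1 / ρ` along unstable curves.
  refine ⟨max (2 * circleDeriv g (proj1 tr)) (ρ⁻¹ * (2 * C) / (c * β)), ?_⟩
  intro A lamA Eu Es r du ds αu αs hA hD hr hB hα₀ W hW
  have hαle : ∀ p, max (2 * circleDeriv g (proj1 tr)) (ρ⁻¹ * (2 * C) / (c * β)) ≤ αu p := fun p =>
    hα₀.trans (ciInf_le ⟨0, by rintro _ ⟨q, rfl⟩; exact (hB.αu_pos q).le⟩ p)
  have hα : ∀ p, 2 * circleDeriv g (proj1 tr) ≤ αu p := fun p => (le_max_left _ _).trans (hαle p)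
  have hαM : ∀ p, ρ⁻¹ * (2 * C) ≤ αu p * (c * β) := fun p =>
    (div_le_iff₀ (mul_pos hc hβ)).1 ((le_max_right _ _).trans (hαle p))
  have hlam : 0 < lamA := inv_pos.1 ((zero_lt_one.trans hmax).trans hD.max_lt)
  have hll : circleDeriv g (proj1 tr) * lamA < 1 :=
    (lt_inv_mul_iff₀' hlam).1 (by simpa using hD.max_lt)
  have hdense := hW.subset_closure hA hB hβ hc hr hg.c2 hg.deriv_pos hg.max_at hα hmax hlam hll
    hαM hρ0 hρh.le (inv_mul_cancel₀ hρ0.ne').ge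
  constructor
  · refine (hdense tr).trans (closure_mono fun p hp => ⟨hp.1, ?_⟩)
    obtain ⟨-, N, hN⟩ := hp
    simp only [centerExponent_skewProduct hA.c2 hg.c2 hr.c2 hg.deriv_pos]
    refine liminf_average_pos (Real.log_pos hμ1)
      (fun n => Real.log_le_log (hg.deriv_pos _) (hg.max_at _)) (N := N) fun n hn => ?_
    obtain ⟨τ, hτ, h⟩ := hN n hn
    rw [h]
    exact Real.log_le_log (by linarith) (hr1 (hτ.trans_lt hρ₁)).le
  · refine (hdense ta).trans (closure_mono fun p hp => ⟨hp.1, ?_⟩)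
    obtain ⟨-, N, hN⟩ := hp
    simp only [centerExponent_skewProduct hA.c2 hg.c2 hr.c2 hg.deriv_pos]
    refine limsup_average_neg (Real.log_neg ((hg.deriv_pos _).trans hν) hν1)
      (fun n => Real.log_le_log (hg.deriv_pos _) (hg.min_at _)) (N := N) fun n hn => ?_
    obtain ⟨τ, hτ, h⟩ := hN n hn
    rw [h]
    exact Real.log_le_log (hg.deriv_pos _) (ha1 (hτ.trans_lt hρ₂)).le
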